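/- **Local comparison of the error estimators.** Let $d\in\{2,3\}$, let $\Omega\subset\mathbb R^d$ be a bounded polygonal ($d=2$) or polyhedral ($d=3$) open set with a conforming simplicial triangulation $\mathcal T_h$ (so $\Omega$ is the interior of the union of the closed simplices $T\in\mathcal T_h$), and write $a(\sigma,\tau)=(\sigma,\tau)$ and $b(\tau,v)=(\operatorname{div}\tau,v)$ with the $L^2(\Omega)$ scalar product $(\cdot,\cdot)$ and norm $\|\cdot\|$. Let $0<\lambda_1\le\lambda_2\le\dots$ be the eigenvalues, repeated according to multiplicity, of the mixed Dirichlet Laplace eigenvalue problem: $(\sigma,u)\in H(\operatorname{div};\Omega)\times L^2(\Omega)$ with $\|u\|=1$ and $$a(\sigma,\tau)+b(\tau,u)=0\quad\forall\tau\in H(\operatorname{div};\Omega),\qquad b(\sigma,v)=-\lambda(u,v)\quad\forall v\in L^2(\Omega),$$ with eigenfunctions $(\sigma_i,u_i)$ such that the $u_i$ are $L^2(\Omega)$-orthonormal. Let $\Sigma_h\subset H(\operatorname{div};\Omega)$ and $M_h\subset L^2(\Omega)$ be mixed finite element spaces on $\mathcal T_h$, that is, finite-dimensional spaces of piecewise polynomials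 (for instance Raviart–Thomas or Brezzi–Douglas–Marini spaces), for which the same problem posed on $\Sigma_h\times M_h$ has the eigenvalues $0<\lambda_{h,1}\le\dots\le\lambda_{h,\dim M_h}$, repeated according to multiplicity, and eigenfunctions $(\sigma_{h,i},u_{h,i})$ with $L^2(\Omega)$-orthonormal $u_{h,i}$. For $w_h\in M_h$ let $\mathsf G_h(w_h)\in\Sigma_h$ be defined by $a(\mathsf G_h(w_h),\tau_h)+b(\tau_h,w_h)=0$ for all $\tau_h\in\Sigma_h$. For $\lambda\in\mathbb R$ and $g\in L^2(\Omega)$ let $T_h^\lambda g\in M_h$ be defined by $b(\mathsf G_h(T_h^\lambda g),v_h)=-(\lambda g,v_h)$ for all $v_h\in M_h$. Let $J=\{n+1,\dots,n+\mathsf N\}$ with $n\ge 0$, $\mathsf N\ge1$ and $n+\mathsf N\le\dim M_h$, let $W_h=\operatorname{span}\{u_{h,j}\mid j\in J\}$ with $L^2(\Omega)$-orthogonal projection $P_h^W$ onto $W_h$, and put $\Lambda_hu_j=P_h^WT_h^{\lambda_j}u_j$ for $j\in J$. For $T\in\mathcal T_h$ and $(s,g)\in\Sigma_h\times M_h$ set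 $$R_T(s,g)=h_T^2\|s-\nabla g\|_T^2+h_T^2\|\operatorname{curl}s\|_T^2+\sum_Fh_F\|[s]_{F,\tan}\|_F^2 ,$$ where the derivatives are taken on $T$, $h_T$ is the diameter of $T$, $F$ runs through the edges ($d=2$) or faces ($d=3$) of $T$, $h_F$ is the length or area of $F$, and $[s]_{F,\tan}$ is the jump of the tangential trace of $s$ across $F$ (the tangential trace itself if $F\subset\partial\Omega$), i.e. $[s]_F\cdot t_F$ with a unit tangent $t_F$ for $d=2$ and $[s]_F\times n_F$ with a unit normal $n_F$ for $d=3$. Define $$\eta_{h,j}(T)^2=R_T(\sigma_{h,j},u_{h,j}),\qquad \mu_h(u_j;T)^2=R_T(\mathsf G_h(\Lambda_hu_j),\Lambda_hu_j).$$ Let $0<\mathsf A\le\mathsf B$ be such that $[\mathsf A,\mathsf B]$ contains $\lambda_j$ and $\lambda_{h,j}$ for all $j\in J$, and suppose that $$\max_{j\in J}\|u_j-\Lambda_hu_j\|\le\sqrt{1+1/(2\mathsf N)}-1 .$$ Then for every $T\in\mathcal T_h$ $$\mathsf N^{-1}\sum_{j\in J}\mu_h(u_j;T)^2\le\Big(\frac{\mathsf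 B}{\mathsf A}\Big)^2\sum_{j\in J}\eta_{h,j}(T)^2\le\Big(\frac{\mathsf B}{\mathsf A}\Big)^2(2\mathsf N+4\mathsf N^2)\sum_{j\in J}\mu_h(u_j;T)^2 .$$ -/

import Mathlib

open MeasureTheory
open scoped ContDiff

noncomputable section

/-- Euclidean space `ℝᵈ`. -/
abbrev Euc (d : ℕ) : Type := EuclideanSpace ℝ (Fin d)

/-- Scalar `L²(Ω)`. -/
abbrev L2Fun {d : ℕ} (Ω : Set (Euc d)) : Type :=
  Lp ℝ 2 ((volume : Measure (Euc d)).restrict Ω)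

/-- Vector-valued `L²(Ω; ℝᵈ)`. -/
abbrev L2Vec {d : ℕ} (Ω : Set (Euc d)) : Type :=
  Lp (Euc d) 2 ((volume : Measure (Euc d)).restrict Ω)

/-! ### The space `H(div; Ω)` -/

/-- `w` is the weak divergence of `σ` in `Ω`:
`∫_Ω σ · ∇φ = - ∫_Ω w φ` for all smooth `φ` with compact support in `Ω`. -/
def IsWeakDiv {d : ℕ} {Ω : Set (Euc d)} (σ : L2Vec Ω) (w : L2Fun Ω) : Prop :=
  ∀ φ : Euc d → ℝ, ContDiff ℝ ∞ φ → HasCompactSupport φ → tsupport φ ⊆ Ω →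
    ∫ x in Ω, fderiv ℝ φ x (σ x) = - ∫ x in Ω, w x * φ x

theorem integrable_fderiv_apply {d : ℕ} {Ω : Set (Euc d)} (σ : L2Vec Ω) {φ : Euc d → ℝ}
    (h1 : ContDiff ℝ ∞ φ) (h2 : HasCompactSupport φ) :
    Integrable (fun x => fderiv ℝ φ x (σ x)) (volume.restrict Ω) := by
  have hc : Continuous (fderiv ℝ φ) := h1.continuous_fderiv (by simp)
  have hm : MemLp (fderiv ℝ φ) 2 ((volume : Measure (Euc d)).restrict Ω) :=
    (hc.memLp_of_hasCompactSupport (h2.fderiv ℝ))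
  have hs : MemLp (fun x => σ x) 2 ((volume : Measure (Euc d)).restrict Ω) := Lp.memLp σ
  have hprod : Integrable (fun x => ‖fderiv ℝ φ x‖ * ‖σ x‖) (volume.restrict Ω) :=
    MemLp.integrable_mul hm.norm hs.norm
  refine hprod.mono' ?_ (Filter.Eventually.of_forall fun x => ?_)
  · exact (ContinuousLinearMap.id ℝ (Euc d →L[ℝ] ℝ)).aestronglyMeasurable_comp₂ hm.1 hs.1
  · exact (fderiv ℝ φ x).le_opNorm (σ x)

theorem integrable_mul_test {d : ℕ} {Ω : Set (Euc d)} (w : L2Fun Ω) {φ : Euc d → ℝ}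
    (h1 : ContDiff ℝ ∞ φ) (h2 : HasCompactSupport φ) :
    Integrable (fun x => w x * φ x) (volume.restrict Ω) := by
  have hm : MemLp φ 2 ((volume : Measure (Euc d)).restrict Ω) :=
    h1.continuous.memLp_of_hasCompactSupport h2
  exact MemLp.integrable_mul (Lp.memLp w) hm

theorem IsWeakDiv.add {d : ℕ} {Ω : Set (Euc d)} {σ τ : L2Vec Ω} {v w : L2Fun Ω}
    (hσ : IsWeakDiv σ v) (hτ : IsWeakDiv τ w) : IsWeakDiv (σ + τ) (v + w) := by
  intro φ h1 h2 h3
  have e1 : ∫ x in Ω, fderiv ℝ φ x ((σ + τ : L2Vec Ω) x)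
      = ∫ x in Ω, (fderiv ℝ φ x (σ x) + fderiv ℝ φ x (τ x)) := by
    refine integral_congr_ae ?_
    filter_upwards [Lp.coeFn_add σ τ] with x hx
    rw [hx, Pi.add_apply, map_add]
  have e2 : ∫ x in Ω, (v + w : L2Fun Ω) x * φ x = ∫ x in Ω, (v x * φ x + w x * φ x) := by
    refine integral_congr_ae ?_
    filter_upwards [Lp.coeFn_add v w] with x hx
    rw [hx, Pi.add_apply, add_mul]
  rw [e1, e2, integral_add (integrable_fderiv_apply σ h1 h2) (integrable_fderiv_apply τ h1 h2),
    integral_add (integrable_mul_test v h1 h2) (integrable_mul_test w h1 h2),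
    hσ φ h1 h2 h3, hτ φ h1 h2 h3]
  ring

theorem IsWeakDiv.smul {d : ℕ} {Ω : Set (Euc d)} {σ : L2Vec Ω} {v : L2Fun Ω} (c : ℝ)
    (hσ : IsWeakDiv σ v) : IsWeakDiv (c • σ) (c • v) := by
  intro φ h1 h2 h3
  have e1 : ∫ x in Ω, fderiv ℝ φ x ((c • σ : L2Vec Ω) x)
      = ∫ x in Ω, c * fderiv ℝ φ x (σ x) := by
    refine integral_congr_ae ?_
    filter_upwards [Lp.coeFn_smul c σ] with x hx
    simp [hx]
  have e2 : ∫ x in Ω, (c • v : L2Fun Ω) x * φ x = ∫ x in Ω, c * (v x * φ x) := by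
    refine integral_congr_ae ?_
    filter_upwards [Lp.coeFn_smul c v] with x hx
    simp [hx, mul_assoc]
  rw [e1, e2, integral_const_mul, integral_const_mul, hσ φ h1 h2 h3]
  ring

theorem IsWeakDiv.zero {d : ℕ} {Ω : Set (Euc d)} :
    IsWeakDiv (0 : L2Vec Ω) (0 : L2Fun Ω) := by
  intro φ _ _ _
  have e1 : ∫ x in Ω, fderiv ℝ φ x ((0 : L2Vec Ω) x) = ∫ x in Ω, (0 : ℝ) := by
    refine integral_congr_ae ?_
    filter_upwards [Lp.coeFn_zero (Euc d) 2 ((volume : Measure (Euc d)).restrict Ω)] with x hx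
    rw [hx, Pi.zero_apply, map_zero]
  have e2 : ∫ x in Ω, (0 : L2Fun Ω) x * φ x = ∫ x in Ω, (0 : ℝ) := by
    refine integral_congr_ae ?_
    filter_upwards [Lp.coeFn_zero ℝ 2 ((volume : Measure (Euc d)).restrict Ω)] with x hx
    rw [hx, Pi.zero_apply, zero_mul]
  rw [e1, e2]
  simp

/-- `H(div; Ω)`: the `L²` vector fields with a weak divergence in `L²`. -/
def Hdiv {d : ℕ} (Ω : Set (Euc d)) : Submodule ℝ (L2Vec Ω) where
  carrier := {σ | ∃ w : L2Fun Ω, IsWeakDiv σ w}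
  add_mem' := fun ⟨v, hv⟩ ⟨w, hw⟩ => ⟨v + w, hv.add hw⟩
  zero_mem' := ⟨0, IsWeakDiv.zero⟩
  smul_mem' := fun c _ ⟨v, hv⟩ => ⟨c • v, hv.smul c⟩

open Classical in
/-- The weak divergence of a field in `H(div; Ω)` (and `0` for any other field). -/
def wdiv {d : ℕ} {Ω : Set (Euc d)} (σ : L2Vec Ω) : L2Fun Ω :=
  if h : ∃ w : L2Fun Ω, IsWeakDiv σ w then h.choose else 0

/-! ### The mixed eigenvalue problem -/

/-- The bilinear form `a(σ, τ) = (σ, τ)`. -/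
def aForm {d : ℕ} {Ω : Set (Euc d)} (σ τ : L2Vec Ω) : ℝ := inner ℝ σ τ

/-- The bilinear form `b(τ, v) = (div τ, v)`. -/
def bForm {d : ℕ} {Ω : Set (Euc d)} (τ : L2Vec Ω) (v : L2Fun Ω) : ℝ := inner ℝ (wdiv τ) v

/-- `(s, w) ∈ S × M` solves the mixed source problem on `S × M` with datum `g`:
`a(s, τ) + b(τ, w) = 0` for all `τ ∈ S` and `b(s, v) = -(g, v)` for all `v ∈ M`. -/
structure IsMixedSolution {d : ℕ} {Ω : Set (Euc d)} (S : Submodule ℝ (L2Vec Ω))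
    (M : Submodule ℝ (L2Fun Ω)) (g : L2Fun Ω) (s : L2Vec Ω) (w : L2Fun Ω) : Prop where
  memS : s ∈ S
  memM : w ∈ M
  eq1 : ∀ τ ∈ S, aForm s τ + bForm τ w = 0
  eq2 : ∀ v ∈ M, bForm s v = - inner ℝ g v

/-- The `(lam i, σ i, u i)`, for `i` in the index set `I`, enumerate in increasing order and with
multiplicity the positive eigenvalues of the mixed eigenvalue problem on `S × M`
together with `L²`-orthonormal eigenfunctions.
For `S = H(div; Ω)`, `M = L²(Ω)` it is the continuous problem, for finite element spaces
the discrete one. The last field says that no eigenfunction is missed. -/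
structure IsEigensystem {d : ℕ} {Ω : Set (Euc d)} (S : Submodule ℝ (L2Vec Ω))
    (M : Submodule ℝ (L2Fun Ω)) (I : Set ℕ) (lam : ℕ → ℝ) (σ : ℕ → L2Vec Ω)
    (u : ℕ → L2Fun Ω) : Prop where
  pos : ∀ i ∈ I, 0 < lam i
  mono : MonotoneOn lam I
  norm_one : ∀ i ∈ I, ‖u i‖ = 1
  orthogonal : ∀ i ∈ I, ∀ j ∈ I, i ≠ j → inner ℝ (u i) (u j) = 0
  eigen : ∀ i ∈ I, IsMixedSolution S M (lam i • u i) (σ i) (u i)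
  complete : ∀ (κ : ℝ) (s : L2Vec Ω) (w : L2Fun Ω), IsMixedSolution S M (κ • w) s w →
    w ∈ Submodule.span ℝ (u '' {i | i ∈ I ∧ lam i = κ})

open Classical in
/-- The operator `G_h` for `S = Σ_h`: the field `s ∈ S` with `a(s, τ) + b(τ, w) = 0` for all
`τ ∈ S` (it exists and is unique if `S` is a finite dimensional subspace of `H(div; Ω)`). -/
def Gh {d : ℕ} {Ω : Set (Euc d)} (S : Submodule ℝ (L2Vec Ω)) (w : L2Fun Ω) : L2Vec Ω :=
  if h : ∃ s ∈ S, ∀ τ ∈ S, aForm s τ + bForm τ w = 0 then h.choose else 0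

open Classical in
/-- The operator `T_h^λ` for `S = Σ_h`, `M = M_h`: the scalar component of the solution of the
discrete source problem with datum `λ g`. -/
def Th {d : ℕ} {Ω : Set (Euc d)} (S : Submodule ℝ (L2Vec Ω)) (M : Submodule ℝ (L2Fun Ω))
    (lam : ℝ) (g : L2Fun Ω) : L2Fun Ω :=
  if h : ∃ w, ∃ s, IsMixedSolution S M (lam • g) s w then h.choose else 0

/-- The discrete cluster space `W_h = span {u_{h,j} | j ∈ J}`. -/
def Wh {d : ℕ} {Ω : Set (Euc d)} (uh : ℕ → L2Fun Ω) (J : Finset ℕ) : Submodule ℝ (L2Fun Ω) :=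
  Submodule.span ℝ (uh '' (J : Set ℕ))

instance {d : ℕ} {Ω : Set (Euc d)} (uh : ℕ → L2Fun Ω) (J : Finset ℕ) :
    FiniteDimensional ℝ (Wh uh J) :=
  FiniteDimensional.span_of_finite ℝ (J.finite_toSet.image uh)

/-- The operator `Λ_h = P_h^W ∘ T_h^λ`, where `P_h^W` is the `L²`-orthogonal projection onto
`W_h`. -/
def Lambdah {d : ℕ} {Ω : Set (Euc d)} (S : Submodule ℝ (L2Vec Ω)) (M : Submodule ℝ (L2Fun Ω))
    (uh : ℕ → L2Fun Ω) (J : Finset ℕ) (lam : ℝ) (u : L2Fun Ω) : L2Fun Ω :=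
  (Wh uh J).starProjection (Th S M lam u)

/-! ### Triangulations and finite element spaces -/

/-- A conforming triangulation (simplicial decomposition) of the polygonal (polyhedral) open set
`Ω`. A cell is given by its set of `d + 1` vertices; the closed simplex is the convex hull. -/
structure Triangulation {d : ℕ} (Ω : Set (Euc d)) where
  cells : Finset (Finset (Euc d))
  card_eq : ∀ T ∈ cells, T.card = d + 1
  indep : ∀ T ∈ cells, AffineIndependent ℝ ((↑) : T → Euc d)
  conforming : ∀ T ∈ cells, ∀ T' ∈ cells,
    convexHull ℝ (T : Set (Euc d)) ∩ convexHull ℝ (T' : Set (Euc d))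
      = convexHull ℝ ((T : Set (Euc d)) ∩ (T' : Set (Euc d)))
  cover : interior (⋃ T ∈ cells, convexHull ℝ (T : Set (Euc d))) = Ω

/-- The value of the polynomial `p` at the point `x`. -/
def evalAt {d : ℕ} (p : MvPolynomial (Fin d) ℝ) (x : Euc d) : ℝ :=
  MvPolynomial.eval (fun i => x i) p

/-- On the simplex `T`, the function `f` agrees almost everywhere with the polynomial `p`. -/
def IsPolyOn {d : ℕ} (T : Finset (Euc d)) (f : Euc d → ℝ) (p : MvPolynomial (Fin d) ℝ) : Prop :=
  ∀ᵐ x ∂((volume : Measure (Euc d)).restrict (interior (convexHull ℝ (T : Set (Euc d))))),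
    f x = evalAt p x

open Classical in
/-- The polynomial `f|_T` of a piecewise polynomial `f`. -/
def polyOn {d : ℕ} (T : Finset (Euc d)) (f : Euc d → ℝ) : MvPolynomial (Fin d) ℝ :=
  if h : ∃ p, IsPolyOn T f p then h.choose else 0

/-- Conforming mixed finite element spaces over a triangulation (such as those of
Raviart–Thomas or Brezzi–Douglas–Marini of any degree): `S = Σ_h` and `M = M_h` are finite
dimensional spaces of piecewise polynomials with `Σ_h ⊆ H(div; Ω)` and `M_h ⊆ L²(Ω)`. -/
structure IsMixedFE {d : ℕ} {Ω : Set (Euc d)} (𝒯 : Triangulation Ω)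
    (S : Submodule ℝ (L2Vec Ω)) (M : Submodule ℝ (L2Fun Ω)) : Prop where
  finS : FiniteDimensional ℝ S
  finM : FiniteDimensional ℝ M
  conf : S ≤ Hdiv Ω
  polyS : ∀ s ∈ S, ∀ T ∈ 𝒯.cells, ∀ i, ∃ p, IsPolyOn T (fun x => s x i) p
  polyM : ∀ v ∈ M, ∀ T ∈ 𝒯.cells, ∃ p, IsPolyOn T (fun x => v x) p

/-! ### The error estimators -/

/-- The components of the polynomial vector field `s|_T`. -/
def vecOn {d : ℕ} {Ω : Set (Euc d)} (s : L2Vec Ω) (T : Finset (Euc d)) (i : Fin d) :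
    MvPolynomial (Fin d) ℝ :=
  polyOn T (fun x => s x i)

/-- The values of the polynomial vector field `s|_T`, extended to all of `ℝᵈ`; on the boundary of
`T` this is the trace from `T`. -/
def traceOn {d : ℕ} {Ω : Set (Euc d)} (s : L2Vec Ω) (T : Finset (Euc d)) (x : Euc d) : Euc d :=
  WithLp.toLp 2 fun i => evalAt (vecOn s T i) x

/-- The residual term `∫_T |s - ∇g|²`. -/
def gradTerm {d : ℕ} {Ω : Set (Euc d)} (T : Finset (Euc d)) (s : L2Vec Ω) (g : L2Fun Ω) : ℝ :=
  ∫ x in convexHull ℝ (T : Set (Euc d)), ∑ i : Fin d,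
    (evalAt (vecOn s T i) x - evalAt (MvPolynomial.pderiv i (polyOn T (fun y => g y))) x) ^ 2

/-- The residual term `∫_T |curl s|²`, where `|curl s|² = ∑_{i < j} (∂_j s_i - ∂_i s_j)²`: for
`d = 2` it is the square of the scalar curl `∂₂s₁ - ∂₁s₂`, and for `d = 3` the squared length of
the vector `∇ × s`. -/
def curlTerm {d : ℕ} {Ω : Set (Euc d)} (T : Finset (Euc d)) (s : L2Vec Ω) : ℝ :=
  ∫ x in convexHull ℝ (T : Set (Euc d)), ∑ i : Fin d, ∑ j ∈ Finset.Ioi i,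
    (evalAt (MvPolynomial.pderiv j (vecOn s T i)) x
      - evalAt (MvPolynomial.pderiv i (vecOn s T j)) x) ^ 2

open Classical in
/-- The jump `[s]_F` across the face `F` of `T`, seen from `T`: the trace from `T` minus the trace
from the other cell that contains `F`, if there is one (a conforming triangulation has at most
one); for a face on the boundary it is the trace from `T`. -/
def jump {d : ℕ} {Ω : Set (Euc d)} (𝒯 : Triangulation Ω) (T F : Finset (Euc d)) (s : L2Vec Ω)
    (x : Euc d) : Euc d :=
  traceOn s T x - ∑ T' ∈ 𝒯.cells.filter (fun T' => T' ≠ T ∧ F ⊆ T'), traceOn s T' x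

/-- The term `‖[s]_F · t_F‖²_F` (`d = 2`), or `‖[s]_F × n_F‖²_F` (`d = 3`): in both cases it is
the integral over `F` of the squared length of the part of the jump tangential to `F`. The measure
on `F` is the length for `d = 2` and the area for `d = 3`. -/
def jumpTerm {d : ℕ} {Ω : Set (Euc d)} (𝒯 : Triangulation Ω) (T F : Finset (Euc d))
    (s : L2Vec Ω) : ℝ :=
  ∫ x in convexHull ℝ (F : Set (Euc d)),
    ‖(vectorSpan ℝ (F : Set (Euc d))).starProjection (jump 𝒯 T F s x)‖ ^ 2
      ∂(μHE[d - 1] : Measure (Euc d))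

/-- The diameter `h_T`. -/
def diamT {d : ℕ} (T : Finset (Euc d)) : ℝ := Metric.diam (convexHull ℝ (T : Set (Euc d)))

/-- The length (`d = 2`) or area (`d = 3`) `h_F` of the face `F`. -/
def sizeF {d : ℕ} (F : Finset (Euc d)) : ℝ :=
  (μHE[d - 1] : Measure (Euc d)).real (convexHull ℝ (F : Set (Euc d)))

/-- The local residual `‖h_T (s - ∇g)‖²_T + ‖h_T curl s‖²_T + ∑_F h_F ‖[s]_F · t_F‖²_F`, where
`F` runs through the edges (faces) of `T`. -/
def residualSq {d : ℕ} {Ω : Set (Euc d)} (𝒯 : Triangulation Ω) (T : Finset (Euc d))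
    (s : L2Vec Ω) (g : L2Fun Ω) : ℝ :=
  diamT T ^ 2 * gradTerm T s g + diamT T ^ 2 * curlTerm T s
    + ∑ F ∈ T.powersetCard d, sizeF F * jumpTerm 𝒯 T F s

/-- The square `η_{h,j}(T)²` of the computable error indicator of a discrete eigenpair
`(σ_{h,j}, u_{h,j})`. -/
def etaSq {d : ℕ} {Ω : Set (Euc d)} (𝒯 : Triangulation Ω) (T : Finset (Euc d))
    (σhj : L2Vec Ω) (uhj : L2Fun Ω) : ℝ :=
  residualSq 𝒯 T σhj uhj

/-- The square `|g_h|²_{η,T}` of the seminorm of `g_h ∈ M_h`. -/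
def etaSeminormSq {d : ℕ} {Ω : Set (Euc d)} (𝒯 : Triangulation Ω) (S : Submodule ℝ (L2Vec Ω))
    (T : Finset (Euc d)) (gh : L2Fun Ω) : ℝ :=
  residualSq 𝒯 T (Gh S gh) gh

/-- The square `μ_h(u; T)² = |Λ_h u|²_{η,T}` of the theoretical error indicator of an
eigenfunction `u` with the eigenvalue `lam`. -/
def muSq {d : ℕ} {Ω : Set (Euc d)} (𝒯 : Triangulation Ω) (S : Submodule ℝ (L2Vec Ω))
    (M : Submodule ℝ (L2Fun Ω)) (uh : ℕ → L2Fun Ω) (J : Finset ℕ) (T : Finset (Euc d))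
    (lam : ℝ) (u : L2Fun Ω) : ℝ :=
  etaSeminormSq 𝒯 S T (Lambdah S M uh J lam u)

end

/-! Write `Q` for the square of the local residual seminorm of `w` paired with its discrete
gradient. Each term of the residual is a weighted integral of squared norms of quantities linear in
the pair `(s, g)`, so `Q (∑ cₖ xₖ) ≤ (∑ cₖ²) ∑ Q xₖ` by Cauchy–Schwarz. Both families of indicators
are values of this one `Q` on `W_h`, because `σ_{h,k}` is the discrete gradient of `u_{h,k}`. It
remains to expand each family in the other and to bound the squares of the coefficients.

For the first inequality, symmetry of the mixed problem gives `Λ_h u_j = ∑ₖ (λ_j / λ_{h,k})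
(u_{h,k}, u_j) u_{h,k}` (`IsEigensystem.Lambdah_eq`). The quotients are at most `B / A`, and
Bessel's inequality bounds the remaining sum of squares by `‖u_j‖² = 1`. Summation over the `N`
indices costs the factor `N`.

For the second, the `Λ_h u_j` are so close to the orthonormal `u_j` that `∑ γ_j² ≤ 2 ‖∑ γ_j Λ_h
u_j‖²` (`Orthonormal.sum_sq_le_of_norm_sub_le`). Hence they are independent and, by dimension, span
`W_h`. Each unit vector `u_{h,k}` is a combination of them with `∑ γ_j² ≤ 2`. This yields the
constant `2 N`, which is below the stated one. -/

open MeasureTheory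
open scoped ContDiff

/-! ### Nonnegative forms with a Cauchy–Schwarz inequality for linear combinations -/

/-- A nonnegative function `Q` with `Q (∑ cₖ xₖ) ≤ (∑ cₖ²) ∑ Q xₖ`, such as the square of a
seminorm. -/
structure SumSqBound {V : Type*} [AddCommGroup V] [Module ℝ V] (Q : V → ℝ) : Prop where
  nonneg : ∀ v, 0 ≤ Q v
  bound : ∀ (K : Finset ℕ) (c : ℕ → ℝ) (x : ℕ → V),
    Q (∑ k ∈ K, c k • x k) ≤ (∑ k ∈ K, c k ^ 2) * ∑ k ∈ K, Q (x k)

namespace SumSqBound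

variable {V E X : Type*} [AddCommGroup V] [Module ℝ V] [NormedAddCommGroup E] [NormedSpace ℝ E]

/-- Triangle inequality, then Cauchy–Schwarz for the sum over `k`. All other instances are built
from this one. -/
theorem norm_sq (ℓ : V →ₗ[ℝ] E) : SumSqBound (fun v => ‖ℓ v‖ ^ 2) where
  nonneg v := by positivity
  bound K c x := by
    have h1 : ‖ℓ (∑ k ∈ K, c k • x k)‖ ≤ ∑ k ∈ K, |c k| * ‖ℓ (x k)‖ := by
      rw [map_sum]
      refine (norm_sum_le _ _).trans (Finset.sum_le_sum fun k _ => ?_)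
      rw [map_smul, norm_smul, Real.norm_eq_abs]
    calc ‖ℓ (∑ k ∈ K, c k • x k)‖ ^ 2 ≤ (∑ k ∈ K, |c k| * ‖ℓ (x k)‖) ^ 2 := by gcongr
      _ ≤ (∑ k ∈ K, |c k| ^ 2) * ∑ k ∈ K, ‖ℓ (x k)‖ ^ 2 :=
        Finset.sum_mul_sq_le_sq_mul_sq _ _ _
      _ = _ := by simp only [sq_abs]

theorem sq {ℓ : V → ℝ} (hℓ : IsLinearMap ℝ ℓ) : SumSqBound (fun v => ℓ v ^ 2) := by
  simpa using norm_sq (hℓ.mk' ℓ)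

theorem add {Q R : V → ℝ} (hQ : SumSqBound Q) (hR : SumSqBound R) :
    SumSqBound (fun v => Q v + R v) where
  nonneg v := add_nonneg (hQ.nonneg v) (hR.nonneg v)
  bound K c x := by
    rw [Finset.sum_add_distrib, mul_add]
    exact add_le_add (hQ.bound K c x) (hR.bound K c x)

theorem const_mul {Q : V → ℝ} (hQ : SumSqBound Q) {r : ℝ} (hr : 0 ≤ r) :
    SumSqBound (fun v => r * Q v) where
  nonneg v := mul_nonneg hr (hQ.nonneg v)
  bound K c x := by
    rw [← Finset.mul_sum, mul_left_comm]
    exact mul_le_mul_of_nonneg_left (hQ.bound K c x) hr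

theorem sum {ι : Type*} (s : Finset ι) {Q : ι → V → ℝ} (hQ : ∀ i ∈ s, SumSqBound (Q i)) :
    SumSqBound (fun v => ∑ i ∈ s, Q i v) where
  nonneg v := Finset.sum_nonneg fun i hi => (hQ i hi).nonneg v
  bound K c x := by
    rw [Finset.sum_comm, Finset.mul_sum]
    exact Finset.sum_le_sum fun i hi => (hQ i hi).bound K c x

/-- The pointwise bound is integrated. Compactness, finite measure and continuity provide
integrability, without which the integral would take its default value `0` and monotonicity could
fail. -/
theorem setIntegral [TopologicalSpace X] [T2Space X] [MeasurableSpace X] [BorelSpace X]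
    {μ : Measure X} {s : Set X} (hs : IsCompact s) (hμ : μ s < ⊤) {q : V → X → ℝ}
    (hc : ∀ v, Continuous (q v)) (hq : ∀ x, SumSqBound (fun v => q v x)) :
    SumSqBound (fun v => ∫ x in s, q v x ∂μ) where
  nonneg v := integral_nonneg fun x => (hq x).nonneg v
  bound K c x := by
    have hint : ∀ v, IntegrableOn (q v) s μ := fun v => by
      obtain ⟨C, hC⟩ := hs.exists_bound_of_continuousOn (hc v).continuousOn
      refine IntegrableOn.of_bound hμ (hc v).measurable.aestronglyMeasurable C ?_
      filter_upwards [ae_restrict_mem hs.measurableSet] with y hy using hC y hy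
    rw [← integral_finsetSum _ fun k _ => hint (x k), ← integral_const_mul]
    exact integral_mono (hint _) ((integrable_finsetSum _ fun k _ => hint (x k)).const_mul _)
      fun y => (hq y).bound K c x

end SumSqBound

/-! ### Piecewise polynomials -/

theorem continuous_evalAt {d : ℕ} (p : MvPolynomial (Fin d) ℝ) :
    Continuous (evalAt p : Euc d → ℝ) :=
  (MvPolynomial.continuous_eval p).comp (by fun_prop)

/-- An open set contains a box, a product of infinite sets, and a polynomial is determined by its
values on such a product. -/
theorem eq_of_evalAt_eqOn_open {d : ℕ} {U : Set (Euc d)} (hU : IsOpen U) (hne : U.Nonempty)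
    {p q : MvPolynomial (Fin d) ℝ} (h : Set.EqOn (evalAt p) (evalAt q) U) : p = q := by
  obtain ⟨x, hx⟩ := hne
  have hV : IsOpen ((fun y : Fin d → ℝ => (WithLp.toLp 2 y : Euc d)) ⁻¹' U) :=
    hU.preimage (by fun_prop)
  obtain ⟨r, hr, hball⟩ := Metric.isOpen_iff.1 hV (fun i => x i) hx
  refine MvPolynomial.funext_set (fun i => Metric.ball (x i) r) (fun i => ?_) fun y hy => ?_
  · rw [Real.ball_eq_Ioo]
    exact Set.Ioo_infinite (by linarith)
  · refine h (hball ?_)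
    rw [ball_pi _ hr]
    exact hy

theorem Triangulation.interior_nonempty {d : ℕ} {Ω : Set (Euc d)} (𝒯 : Triangulation Ω)
    {T : Finset (Euc d)} (hT : T ∈ 𝒯.cells) :
    (interior (convexHull ℝ (T : Set (Euc d)))).Nonempty := by
  rw [interior_convexHull_nonempty_iff_affineSpan_eq_top]
  have h := (𝒯.indep T hT).affineSpan_eq_top_iff_card_eq_finrank_add_one.2 (by
    simp [𝒯.card_eq T hT])
  simpa using h

theorem Triangulation.interior_subset {d : ℕ} {Ω : Set (Euc d)} (𝒯 : Triangulation Ω)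
    {T : Finset (Euc d)} (hT : T ∈ 𝒯.cells) :
    interior (convexHull ℝ (T : Set (Euc d))) ⊆ Ω := by
  rw [← 𝒯.cover]
  exact interior_mono (Set.subset_biUnion_of_mem (u := fun T : Finset (Euc d) =>
    convexHull ℝ (T : Set (Euc d))) hT)

section polyOn

variable {d : ℕ} {Ω : Set (Euc d)} {𝒯 : Triangulation Ω} {T : Finset (Euc d)}

/-- A cell has nonempty interior, and continuous functions that agree almost everywhere on an open
set agree there. So the polynomial chosen in `polyOn` is unique, which makes the choice linear in
`f`. -/
theorem Triangulation.polyOn_eq (𝒯 : Triangulation Ω) (hT : T ∈ 𝒯.cells) {f : Euc d → ℝ}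
    {p : MvPolynomial (Fin d) ℝ} (hp : IsPolyOn T f p) : polyOn T f = p := by
  have h : ∃ p, IsPolyOn T f p := ⟨p, hp⟩
  rw [polyOn, dif_pos h]
  refine eq_of_evalAt_eqOn_open isOpen_interior (𝒯.interior_nonempty hT) ?_
  refine Measure.eqOn_open_of_ae_eq (μ := volume) ?_ isOpen_interior
    (continuous_evalAt _).continuousOn (continuous_evalAt _).continuousOn
  filter_upwards [h.choose_spec, hp] with x h1 h2
  rw [← h1, h2]

theorem isPolyOn_polyOn {f : Euc d → ℝ} (h : ∃ p, IsPolyOn T f p) :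
    IsPolyOn T f (polyOn T f) := by
  rw [polyOn, dif_pos h]
  exact h.choose_spec

theorem ae_interior_of_ae (𝒯 : Triangulation Ω) (hT : T ∈ 𝒯.cells) {P : Euc d → Prop}
    (h : ∀ᵐ x ∂((volume : Measure (Euc d)).restrict Ω), P x) :
    ∀ᵐ x ∂((volume : Measure (Euc d)).restrict (interior (convexHull ℝ (T : Set (Euc d))))),
      P x :=
  ae_restrict_of_ae_restrict_of_subset (𝒯.interior_subset hT) h

theorem isLinearMap_polyOn {V : Type*} [AddCommGroup V] [Module ℝ V] (𝒯 : Triangulation Ω)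
    (hT : T ∈ 𝒯.cells) (f : V → Euc d → ℝ) (hf : ∀ v, ∃ p, IsPolyOn T (f v) p)
    (hadd : ∀ v w, ∀ᵐ x ∂((volume : Measure (Euc d)).restrict Ω), f (v + w) x = f v x + f w x)
    (hsmul : ∀ (c : ℝ) v, ∀ᵐ x ∂((volume : Measure (Euc d)).restrict Ω),
      f (c • v) x = c * f v x) :
    IsLinearMap ℝ (fun v => polyOn T (f v)) where
  map_add v w := by
    refine 𝒯.polyOn_eq hT ?_
    filter_upwards [isPolyOn_polyOn (hf v), isPolyOn_polyOn (hf w),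
      ae_interior_of_ae 𝒯 hT (hadd v w)] with x h1 h2 h3
    rw [h3, h1, h2, evalAt, evalAt, evalAt, map_add]
  map_smul c v := by
    refine 𝒯.polyOn_eq hT ?_
    filter_upwards [isPolyOn_polyOn (hf v), ae_interior_of_ae 𝒯 hT (hsmul c v)] with x h1 h3
    rw [h3, h1, evalAt, evalAt, MvPolynomial.smul_eval]

end polyOn

/-! ### The measure of a face -/

/-- The simplex lies in an isometric copy of a ball of its `k`-dimensional direction space, where
the `k`-dimensional measure is finite on compact sets. -/
theorem euclideanHausdorffMeasure_convexHull_lt_top {d k : ℕ} {F : Finset (Euc d)}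
    (hF : AffineIndependent ℝ ((↑) : F → Euc d)) (hcard : F.card = k + 1) :
    (μHE[k] : Measure (Euc d)) (convexHull ℝ (F : Set (Euc d))) < ⊤ := by
  obtain ⟨p, hp⟩ : F.Nonempty := Finset.card_pos.1 (by omega)
  set V := vectorSpan ℝ (F : Set (Euc d)) with hV
  have hrank : Module.finrank ℝ V = k := by
    have hr : Set.range ((↑) : F → Euc d) = (F : Set (Euc d)) := by ext; simp
    rw [hV, ← hr]
    exact hF.finrank_vectorSpan (by simpa using hcard)
  have hiso : Isometry (fun v : V => (v : Euc d) + p) :=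
    (IsometryEquiv.addRight p).isometry.comp isometry_subtype_coe
  set K := convexHull ℝ (F : Set (Euc d)) with hK
  have hKc : IsCompact K := F.finite_toSet.isCompact_convexHull ℝ
  obtain ⟨R, hR⟩ := hKc.isBounded.subset_closedBall p
  have hsub : K ⊆ (fun v : V => (v : Euc d) + p) '' Metric.closedBall 0 R := by
    intro x hx
    have hx1 : x ∈ affineSpan ℝ (F : Set (Euc d)) := convexHull_subset_affineSpan _ hx
    have hx2 : x - p ∈ V := by
      have := AffineSubspace.vsub_mem_direction hx1 (mem_affineSpan ℝ (Finset.mem_coe.2 hp))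
      rwa [direction_affineSpan] at this
    refine ⟨⟨x - p, hx2⟩, ?_, by simp⟩
    have := hR hx
    rw [mem_closedBall_iff_norm] at this
    simpa using this
  refine (measure_mono hsub).trans_lt ?_
  rw [hiso.euclideanHausdorffMeasure_image, ← hrank]
  exact (isCompact_closedBall _ _).measure_lt_top

/-! ### The local residual is the square of a seminorm -/

section Residual

variable {d : ℕ} {Ω : Set (Euc d)} {𝒯 : Triangulation Ω} {S : Submodule ℝ (L2Vec Ω)}
  {M : Submodule ℝ (L2Fun Ω)} {T : Finset (Euc d)}

theorem IsMixedFE.isLinearMap_vecOn (h : IsMixedFE 𝒯 S M) (hT : T ∈ 𝒯.cells) (i : Fin d) :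
    IsLinearMap ℝ (fun v : S × M => vecOn (v.1 : L2Vec Ω) T i) := by
  refine isLinearMap_polyOn 𝒯 hT (fun (v : S × M) x => (v.1 : L2Vec Ω) x i)
    (fun v => h.polyS _ v.1.2 T hT i) (fun v w => ?_) fun c v => ?_
  · filter_upwards [Lp.coeFn_add (v.1 : L2Vec Ω) (w.1 : L2Vec Ω)] with x hx
    exact congrArg (fun y => y i) hx
  · filter_upwards [Lp.coeFn_smul c (v.1 : L2Vec Ω)] with x hx
    simp [hx]

theorem IsMixedFE.isLinearMap_polyOn (h : IsMixedFE 𝒯 S M) (hT : T ∈ 𝒯.cells) :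
    IsLinearMap ℝ (fun v : S × M => polyOn T (fun y => (v.2 : L2Fun Ω) y)) := by
  refine _root_.isLinearMap_polyOn 𝒯 hT (fun (v : S × M) x => (v.2 : L2Fun Ω) x)
    (fun v => h.polyM _ v.2.2 T hT) (fun v w => ?_) fun c v => ?_
  · filter_upwards [Lp.coeFn_add (v.2 : L2Fun Ω) (w.2 : L2Fun Ω)] with x hx
    exact hx
  · filter_upwards [Lp.coeFn_smul c (v.2 : L2Fun Ω)] with x hx
    simp [hx]

theorem IsMixedFE.isLinearMap_traceOn (h : IsMixedFE 𝒯 S M) (hT : T ∈ 𝒯.cells) (x : Euc d) :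
    IsLinearMap ℝ (fun v : S × M => traceOn (v.1 : L2Vec Ω) T x) where
  map_add v w := by
    ext i
    simp only [traceOn, PiLp.add_apply, evalAt]
    rw [(h.isLinearMap_vecOn hT i).map_add, map_add]
  map_smul c v := by
    ext i
    simp only [traceOn, PiLp.smul_apply, evalAt]
    rw [(h.isLinearMap_vecOn hT i).map_smul, MvPolynomial.smul_eval, smul_eq_mul]

theorem IsMixedFE.isLinearMap_jump (h : IsMixedFE 𝒯 S M) (hT : T ∈ 𝒯.cells)
    (F : Finset (Euc d)) (x : Euc d) :
    IsLinearMap ℝ (fun v : S × M => jump 𝒯 T F (v.1 : L2Vec Ω) x) where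
  map_add v w := by
    simp only [jump]
    rw [(h.isLinearMap_traceOn hT x).map_add, Finset.sum_congr rfl fun T' hT' =>
      (h.isLinearMap_traceOn (Finset.mem_filter.1 hT').1 x).map_add v w, Finset.sum_add_distrib]
    abel
  map_smul c v := by
    simp only [jump]
    rw [(h.isLinearMap_traceOn hT x).map_smul, Finset.sum_congr rfl fun T' hT' =>
      (h.isLinearMap_traceOn (Finset.mem_filter.1 hT').1 x).map_smul c v, ← Finset.smul_sum,
      smul_sub]

theorem continuous_traceOn (s : L2Vec Ω) (T : Finset (Euc d)) : Continuous (traceOn s T) :=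
  (PiLp.continuous_toLp 2 _).comp (continuous_pi fun _ => continuous_evalAt _)

theorem continuous_jump (𝒯 : Triangulation Ω) (T F : Finset (Euc d)) (s : L2Vec Ω) :
    Continuous (jump 𝒯 T F s) :=
  (continuous_traceOn s T).sub (continuous_finsetSum _ fun T' _ => continuous_traceOn s T')

theorem Finset.isCompact_convexHull_euc (T : Finset (Euc d)) :
    IsCompact (convexHull ℝ (T : Set (Euc d))) :=
  T.finite_toSet.isCompact_convexHull ℝ

theorem IsMixedFE.sumSqBound_gradTerm (h : IsMixedFE 𝒯 S M) (hT : T ∈ 𝒯.cells) :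
    SumSqBound (fun v : S × M => gradTerm T (v.1 : L2Vec Ω) (v.2 : L2Fun Ω)) := by
  refine SumSqBound.setIntegral T.isCompact_convexHull_euc
    T.isCompact_convexHull_euc.measure_lt_top (fun v => ?_) fun x => ?_
  · exact continuous_finsetSum _ fun i _ => ((continuous_evalAt _).sub (continuous_evalAt _)).pow 2
  · refine SumSqBound.sum _ fun i _ => SumSqBound.sq (ℓ := fun v : S × M =>
      evalAt (vecOn (v.1 : L2Vec Ω) T i) x
        - evalAt (MvPolynomial.pderiv i (polyOn T (fun y => (v.2 : L2Fun Ω) y))) x)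
      ⟨fun v w => ?_, fun c v => ?_⟩
    · simp only [evalAt]
      rw [(h.isLinearMap_vecOn hT i).map_add, (h.isLinearMap_polyOn hT).map_add]
      simp only [map_add]
      ring
    · simp only [evalAt]
      rw [(h.isLinearMap_vecOn hT i).map_smul, (h.isLinearMap_polyOn hT).map_smul]
      simp only [Derivation.map_smul, MvPolynomial.smul_eval, smul_eq_mul]
      ring

theorem IsMixedFE.sumSqBound_curlTerm (h : IsMixedFE 𝒯 S M) (hT : T ∈ 𝒯.cells) :
    SumSqBound (fun v : S × M => curlTerm T (v.1 : L2Vec Ω)) := by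
  refine SumSqBound.setIntegral T.isCompact_convexHull_euc
    T.isCompact_convexHull_euc.measure_lt_top (fun v => ?_) fun x => ?_
  · exact continuous_finsetSum _ fun i _ => continuous_finsetSum _ fun j _ =>
      ((continuous_evalAt _).sub (continuous_evalAt _)).pow 2
  · refine SumSqBound.sum _ fun i _ => SumSqBound.sum _ fun j _ =>
      SumSqBound.sq (ℓ := fun v : S × M =>
        evalAt (MvPolynomial.pderiv j (vecOn (v.1 : L2Vec Ω) T i)) x
          - evalAt (MvPolynomial.pderiv i (vecOn (v.1 : L2Vec Ω) T j)) x)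
      ⟨fun v w => ?_, fun c v => ?_⟩
    · simp only [evalAt]
      rw [(h.isLinearMap_vecOn hT i).map_add, (h.isLinearMap_vecOn hT j).map_add]
      simp only [map_add]
      ring
    · simp only [evalAt]
      rw [(h.isLinearMap_vecOn hT i).map_smul, (h.isLinearMap_vecOn hT j).map_smul]
      simp only [Derivation.map_smul, MvPolynomial.smul_eval, smul_eq_mul]
      ring

/-- The condition `d ≠ 0` makes the truncated `d - 1` the true dimension of a face with `d`
vertices, so that its measure is finite. -/
theorem IsMixedFE.sumSqBound_jumpTerm (h : IsMixedFE 𝒯 S M) (hd : d ≠ 0) (hT : T ∈ 𝒯.cells)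
    {F : Finset (Euc d)} (hF : F ∈ T.powersetCard d) :
    SumSqBound (fun v : S × M => jumpTerm 𝒯 T F (v.1 : L2Vec Ω)) := by
  obtain ⟨hFT, hcard⟩ := Finset.mem_powersetCard.1 hF
  refine SumSqBound.setIntegral F.isCompact_convexHull_euc
    (euclideanHausdorffMeasure_convexHull_lt_top ((𝒯.indep T hT).mono hFT) (by omega))
    (fun v => ?_) fun x => ?_
  · exact (((vectorSpan ℝ (F : Set (Euc d))).starProjection.continuous.comp
      (continuous_jump 𝒯 T F _)).norm).pow 2
  · exact SumSqBound.norm_sq ((vectorSpan ℝ (F : Set (Euc d))).starProjection.toLinearMap.comp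
      ((h.isLinearMap_jump hT F x).mk' _))

theorem IsMixedFE.sumSqBound_residualSq (h : IsMixedFE 𝒯 S M) (hd : d ≠ 0) (hT : T ∈ 𝒯.cells) :
    SumSqBound (fun v : S × M => residualSq 𝒯 T (v.1 : L2Vec Ω) (v.2 : L2Fun Ω)) :=
  (((h.sumSqBound_gradTerm hT).const_mul (sq_nonneg _)).add
    ((h.sumSqBound_curlTerm hT).const_mul (sq_nonneg _))).add
    (SumSqBound.sum _ fun _ hF => (h.sumSqBound_jumpTerm hd hT hF).const_mul measureReal_nonneg)

end Residual

/-! ### The discrete gradient -/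

section Gradient

variable {d : ℕ} {Ω : Set (Euc d)} {S : Submodule ℝ (L2Vec Ω)} {M : Submodule ℝ (L2Fun Ω)}

/-- The graph of the discrete gradient `G_h`. -/
def ghGraph (S : Submodule ℝ (L2Vec Ω)) (M : Submodule ℝ (L2Fun Ω)) :
    Submodule ℝ (S × M) where
  carrier := {v | ∀ τ ∈ S, aForm (v.1 : L2Vec Ω) τ + bForm τ (v.2 : L2Fun Ω) = 0}
  zero_mem' := by intro τ _; simp [aForm, bForm]
  add_mem' := by
    intro v w hv hw τ hτ
    have h1 := hv τ hτ
    have h2 := hw τ hτ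
    simp only [aForm, bForm, Prod.fst_add, Prod.snd_add, Submodule.coe_add, inner_add_left,
      inner_add_right] at *
    linarith
  smul_mem' := by
    intro c v hv τ hτ
    have h1 := hv τ hτ
    simp only [aForm, bForm, Prod.smul_fst, Prod.smul_snd, Submodule.coe_smul,
      real_inner_smul_left, real_inner_smul_right] at *
    rw [← mul_add, h1, mul_zero]

/-- Two candidates differ by an element of `S`. Testing with this difference shows that its norm
vanishes. -/
theorem Gh_eq {s : L2Vec Ω} {w : L2Fun Ω} (hs : s ∈ S)
    (h : ∀ τ ∈ S, aForm s τ + bForm τ w = 0) : Gh S w = s := by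
  have hex : ∃ s ∈ S, ∀ τ ∈ S, aForm s τ + bForm τ w = 0 := ⟨s, hs, h⟩
  rw [Gh, dif_pos hex]
  obtain ⟨h1, h2⟩ := hex.choose_spec
  set r := hex.choose
  have hd : r - s ∈ S := S.sub_mem h1 hs
  have e1 := h2 _ hd
  have e2 := h _ hd
  have e3 : inner ℝ (r - s) (r - s) = 0 := by
    simp only [aForm] at e1 e2
    rw [inner_sub_left]
    linarith
  exact sub_eq_zero.1 (inner_self_eq_zero.1 e3)

theorem Gh_eq_of_mem_ghGraph {v : S × M} (hv : v ∈ ghGraph S M) :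
    Gh S (v.2 : L2Fun Ω) = v.1 :=
  Gh_eq v.1.2 hv

theorem etaSeminormSq_of_mem_ghGraph (𝒯 : Triangulation Ω) (T : Finset (Euc d)) {v : S × M}
    (hv : v ∈ ghGraph S M) :
    etaSeminormSq 𝒯 S T (v.2 : L2Fun Ω) = residualSq 𝒯 T (v.1 : L2Vec Ω) (v.2 : L2Fun Ω) := by
  rw [etaSeminormSq, Gh_eq_of_mem_ghGraph hv]

/-- For linear combinations in the domain of the discrete gradient, the square of the residual
seminorm satisfies a Cauchy–Schwarz inequality. -/
theorem etaSeminormSq_sum_le {𝒯 : Triangulation Ω} {T : Finset (Euc d)}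
    (h : IsMixedFE 𝒯 S M) (hd : d ≠ 0) (hT : T ∈ 𝒯.cells) (K : Finset ℕ) (c : ℕ → ℝ)
    (x : ℕ → L2Fun Ω) (hx : ∀ k ∈ K, ∃ v ∈ ghGraph S M, (v.2 : L2Fun Ω) = x k) :
    etaSeminormSq 𝒯 S T (∑ k ∈ K, c k • x k)
      ≤ (∑ k ∈ K, c k ^ 2) * ∑ k ∈ K, etaSeminormSq 𝒯 S T (x k) := by
  -- The graph is a subspace, so the same combination of pairs represents the combination of the `x
  -- k` together with its discrete gradient. Linearity of `G_h` itself is never needed.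
  choose! v hv hvx using hx
  have hsum : ∑ k ∈ K, c k • v k ∈ ghGraph S M :=
    Submodule.sum_mem _ fun k hk => Submodule.smul_mem _ _ (hv k hk)
  have e : ∑ k ∈ K, c k • x k = ((∑ k ∈ K, c k • v k).2 : L2Fun Ω) := by
    rw [Prod.snd_sum, Submodule.coe_sum]
    exact Finset.sum_congr rfl fun k hk => by simp [hvx k hk]
  rw [e, etaSeminormSq_of_mem_ghGraph 𝒯 T hsum]
  have e' : ∑ k ∈ K, etaSeminormSq 𝒯 S T (x k)
      = ∑ k ∈ K, residualSq 𝒯 T ((v k).1 : L2Vec Ω) ((v k).2 : L2Fun Ω) :=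
    Finset.sum_congr rfl fun k hk => by
      rw [← hvx k hk, etaSeminormSq_of_mem_ghGraph 𝒯 T (hv k hk)]
  rw [e']
  exact (h.sumSqBound_residualSq hd hT).bound K c v

theorem etaSeminormSq_nonneg {𝒯 : Triangulation Ω} {T : Finset (Euc d)}
    (h : IsMixedFE 𝒯 S M) (hd : d ≠ 0) (hT : T ∈ 𝒯.cells) {w : L2Fun Ω}
    (hw : ∃ v ∈ ghGraph S M, (v.2 : L2Fun Ω) = w) : 0 ≤ etaSeminormSq 𝒯 S T w := by
  obtain ⟨v, hv, rfl⟩ := hw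
  rw [etaSeminormSq_of_mem_ghGraph 𝒯 T hv]
  exact (h.sumSqBound_residualSq hd hT).nonneg v

end Gradient

/-! ### Finite orthonormal families and their perturbations -/

section Orthonormal

variable {E : Type*} [NormedAddCommGroup E] [InnerProductSpace ℝ E] {J : Finset ℕ} {u w : ℕ → E}

theorem Orthonormal.norm_sum_smul_sq (hu : Orthonormal ℝ (fun j : J => u j)) (γ : ℕ → ℝ) :
    ‖∑ j ∈ J, γ j • u j‖ ^ 2 = ∑ j ∈ J, γ j ^ 2 := by
  rw [← real_inner_self_eq_norm_sq, ← Finset.sum_coe_sort J (fun j => γ j • u j),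
    ← Finset.sum_coe_sort J (fun j => γ j ^ 2)]
  rw [hu.inner_sum (fun j : J => γ j) (fun j : J => γ j) Finset.univ]
  simp [sq]

theorem Orthonormal.sum_inner_sq_le (hu : Orthonormal ℝ (fun j : J => u j)) (x : E) :
    ∑ j ∈ J, inner ℝ (u j) x ^ 2 ≤ ‖x‖ ^ 2 := by
  have h := hu.sum_inner_products_le x (s := Finset.univ)
  simpa only [Real.norm_eq_abs, sq_abs, Finset.sum_coe_sort J (fun j => inner ℝ (u j) x ^ 2)]
    using h

theorem Orthonormal.starProjection_span_eq (hu : Orthonormal ℝ (fun j : J => u j))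
    [(Submodule.span ℝ (u '' (J : Set ℕ))).HasOrthogonalProjection] (x : E) :
    (Submodule.span ℝ (u '' (J : Set ℕ))).starProjection x
      = ∑ j ∈ J, inner ℝ (u j) x • u j := by
  refine Submodule.eq_starProjection_of_mem_orthogonal
    (K := Submodule.span ℝ (u '' (J : Set ℕ))) ?_ ?_
  · exact Submodule.sum_mem _ fun j hj =>
      Submodule.smul_mem _ _ (Submodule.subset_span ⟨j, hj, rfl⟩)
  · rw [Submodule.mem_orthogonal]
    intro v hv
    induction hv using Submodule.span_induction with
    | mem v hv =>
      obtain ⟨k, hk, rfl⟩ := hv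
      rw [inner_sub_right, ← Finset.sum_coe_sort J (fun j => inner ℝ (u j) x • u j),
        hu.inner_right_fintype (fun j : J => inner ℝ (u j) x) ⟨k, hk⟩, sub_self]
    | zero => simp
    | add v w _ _ hv hw => rw [inner_add_left, hv, hw, add_zero]
    | smul c v _ hv => rw [real_inner_smul_left, hv, mul_zero]

theorem Orthonormal.sum_sq_le_of_norm_sub_le (hu : Orthonormal ℝ (fun j : J => u j))
    (hJ : 0 < J.card)
    (h : ∀ j ∈ J, ‖u j - w j‖ ≤ Real.sqrt (1 + 1 / (2 * (J.card : ℝ))) - 1) (γ : ℕ → ℝ) :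
    ∑ j ∈ J, γ j ^ 2 ≤ 2 * ‖∑ j ∈ J, γ j • w j‖ ^ 2 := by
  have hN : (1 : ℝ) ≤ J.card := by exact_mod_cast hJ
  set N : ℝ := (J.card : ℝ)
  -- Square `1 + 1 / (4 N)` and drop the last term.
  have hε : Real.sqrt (1 + 1 / (2 * N)) - 1 ≤ 1 / (4 * N) := by
    rw [sub_le_iff_le_add', Real.sqrt_le_left (by positivity)]
    have : (1 + 1 / (4 * N)) ^ 2 = 1 + 1 / (2 * N) + (1 / (4 * N)) ^ 2 := by
      field_simp
      ring
    rw [this]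
    nlinarith [sq_nonneg (1 / (4 * N))]
  have h1 : ‖∑ j ∈ J, γ j • (u j - w j)‖ ≤ (∑ j ∈ J, |γ j|) * (1 / (4 * N)) := by
    rw [Finset.sum_mul]
    refine (norm_sum_le _ _).trans (Finset.sum_le_sum fun j hj => ?_)
    rw [norm_smul, Real.norm_eq_abs]
    exact mul_le_mul_of_nonneg_left ((h j hj).trans hε) (abs_nonneg _)
  have h2 : (∑ j ∈ J, |γ j|) ^ 2 ≤ N * ∑ j ∈ J, γ j ^ 2 := by
    simpa only [sq_abs] using sq_sum_le_card_mul_sum_sq (s := J) (f := fun j => |γ j|)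
  rw [← hu.norm_sum_smul_sq γ] at h2 ⊢
  have h3 : ∑ j ∈ J, γ j • u j = ∑ j ∈ J, γ j • (u j - w j) + ∑ j ∈ J, γ j • w j := by
    simp [smul_sub, Finset.sum_sub_distrib]
  have h4 := norm_add_le (∑ j ∈ J, γ j • (u j - w j)) (∑ j ∈ J, γ j • w j)
  rw [← h3] at h4
  set a := ‖∑ j ∈ J, γ j • u j‖
  set b := ‖∑ j ∈ J, γ j • w j‖
  set g := ∑ j ∈ J, |γ j|
  have ha : 0 ≤ a := norm_nonneg _
  have hb : 0 ≤ b := norm_nonneg _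
  -- From `g² ≤ N a²` and `N ≥ 1` the cruder `g ≤ N a` follows, and it suffices.
  have h5 : g * (1 / (4 * N)) ≤ a / 4 := by
    have h6 : g ≤ N * a := by
      refine abs_le_of_sq_le_sq' ?_ (by positivity) |>.2
      nlinarith [mul_nonneg (sub_nonneg.2 hN) (sq_nonneg a)]
    calc g * (1 / (4 * N)) ≤ N * a * (1 / (4 * N)) := by gcongr
      _ = a / 4 := by field_simp
  -- The perturbation absorbs a quarter of `a`; squaring gives `16 / 9 ≤ 2`.
  have h7 : a ≤ 4 / 3 * b := by linarith
  nlinarith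

/-- The coefficient bound forces linear independence, and `J.card` independent vectors fill a space
spanned by `J.card` vectors. -/
theorem span_image_eq_of_sum_sq_le (hw : ∀ j ∈ J, w j ∈ Submodule.span ℝ (u '' (J : Set ℕ)))
    {C : ℝ} (h : ∀ γ : ℕ → ℝ, ∑ j ∈ J, γ j ^ 2 ≤ C * ‖∑ j ∈ J, γ j • w j‖ ^ 2) :
    Submodule.span ℝ (w '' (J : Set ℕ)) = Submodule.span ℝ (u '' (J : Set ℕ)) := by
  have hfin : FiniteDimensional ℝ (Submodule.span ℝ (u '' (J : Set ℕ))) :=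
    FiniteDimensional.span_of_finite ℝ (J.finite_toSet.image u)
  have hli : LinearIndependent ℝ (fun j : (J : Set ℕ) => w j) := by
    refine linearIndepOn_finset_iff.2 fun γ hγ j hj => ?_
    have h1 := h γ
    rw [hγ] at h1
    have h2 : γ j ^ 2 ≤ 0 :=
      (Finset.single_le_sum (fun i _ => sq_nonneg (γ i)) hj).trans (by simpa using h1)
    exact pow_eq_zero_iff two_ne_zero |>.1 (le_antisymm h2 (sq_nonneg _))
  refine Submodule.eq_of_le_of_finrank_le (Submodule.span_le.2 ?_) ?_
  · rintro _ ⟨j, hj, rfl⟩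
    exact hw j hj
  · have h1 : Module.finrank ℝ (Submodule.span ℝ (u '' (J : Set ℕ))) ≤ J.card := by
      classical
      rw [← Finset.coe_image]
      exact (finrank_span_finset_le_card _).trans Finset.card_image_le
    have h2 := finrank_span_eq_card hli
    rw [← Set.image_eq_range] at h2
    rw [h2]
    simpa using h1

end Orthonormal

/-! ### The discrete eigenfunctions and the operator `Λ_h` -/

section Eigensystem

variable {d : ℕ} {Ω : Set (Euc d)} {S : Submodule ℝ (L2Vec Ω)} {M : Submodule ℝ (L2Fun Ω)}
  {I : Set ℕ} {lam : ℕ → ℝ} {σ : ℕ → L2Vec Ω} {u : ℕ → L2Fun Ω}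

theorem IsEigensystem.orthonormal (h : IsEigensystem S M I lam σ u) {J : Finset ℕ}
    (hJ : (J : Set ℕ) ⊆ I) : Orthonormal ℝ (fun j : J => u j) :=
  ⟨fun j => h.norm_one j (hJ j.2), fun i j hij =>
    h.orthogonal i (hJ i.2) j (hJ j.2) fun e => hij (Subtype.ext e)⟩

/-- The discrete eigenfunctions diagonalize the discrete solution operator. -/
theorem IsMixedSolution.inner_eigen {κ : ℝ} {s : L2Vec Ω} {w g : L2Fun Ω} {r : L2Vec Ω}
    {z : L2Fun Ω} (he : IsMixedSolution S M (κ • w) s w) (hz : IsMixedSolution S M g r z) :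
    κ * inner ℝ w z = inner ℝ w g := by
  have e1 := he.eq1 r hz.memS
  have e2 := he.eq2 z hz.memM
  have e3 := hz.eq1 s he.memS
  have e4 := hz.eq2 w he.memM
  -- Testing each problem with the solution of the other shows that both sides of the claim equal
  -- `a(r, s)`.
  have e5 : aForm s r = aForm r s := real_inner_comm _ _
  rw [real_inner_smul_left] at e2
  rw [real_inner_comm g w]
  linarith

theorem Th_isMixedSolution {κ : ℝ} {g : L2Fun Ω} (h : Th S M κ g ≠ 0) :
    ∃ s, IsMixedSolution S M (κ • g) s (Th S M κ g) := by
  by_cases hex : ∃ w, ∃ s, IsMixedSolution S M (κ • g) s w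
  · rw [Th, dif_pos hex]
    exact hex.choose_spec
  · exact absurd (by rw [Th, dif_neg hex]) h

/-- If the discrete source problem has the solution `T_h^κ g`, then
`Λ_h g = ∑ (κ / λ_{h,k}) (u_{h,k}, g) u_{h,k}`. -/
theorem IsEigensystem.Lambdah_eq (h : IsEigensystem S M I lam σ u) {J : Finset ℕ}
    (hJ : (J : Set ℕ) ⊆ I) {κ : ℝ} {g : L2Fun Ω} (hT : Th S M κ g ≠ 0) :
    Lambdah S M u J κ g = ∑ k ∈ J, (κ / lam k * inner ℝ (u k) g) • u k := by
  obtain ⟨s, hs⟩ := Th_isMixedSolution hT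
  have : FiniteDimensional ℝ (Submodule.span ℝ (u '' (J : Set ℕ))) :=
    FiniteDimensional.span_of_finite ℝ (J.finite_toSet.image u)
  refine ((h.orthonormal hJ).starProjection_span_eq _).trans
    (Finset.sum_congr rfl fun k hk => ?_)
  have h1 := (h.eigen k (hJ hk)).inner_eigen hs
  have h2 := (h.pos k (hJ hk)).ne'
  rw [real_inner_smul_right] at h1
  congr 1
  field_simp
  linarith

theorem IsEigensystem.mem_ghGraph (h : IsEigensystem S M I lam σ u) {k : ℕ} (hk : k ∈ I) :
    ∃ v ∈ ghGraph S M, (v.2 : L2Fun Ω) = u k :=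
  ⟨(⟨σ k, (h.eigen k hk).memS⟩, ⟨u k, (h.eigen k hk).memM⟩), (h.eigen k hk).eq1, rfl⟩

/-- The projection of the graph to `M` is a subspace containing the eigenfunctions, so discrete
gradients exist on all of `W_h` without a general solvability result. -/
theorem IsEigensystem.mem_ghGraph_of_mem_Wh (h : IsEigensystem S M I lam σ u) {J : Finset ℕ}
    (hJ : (J : Set ℕ) ⊆ I) {w : L2Fun Ω} (hw : w ∈ Wh u J) :
    ∃ v ∈ ghGraph S M, (v.2 : L2Fun Ω) = w := by
  have hle : Wh u J ≤ (ghGraph S M).map (M.subtype.comp (LinearMap.snd ℝ S M)) := by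
    refine Submodule.span_le.2 ?_
    rintro _ ⟨k, hk, rfl⟩
    exact h.mem_ghGraph (hJ hk)
  exact hle hw

theorem IsEigensystem.etaSq_eq (h : IsEigensystem S M I lam σ u) (𝒯 : Triangulation Ω)
    (T : Finset (Euc d)) {k : ℕ} (hk : k ∈ I) :
    etaSq 𝒯 T (σ k) (u k) = etaSeminormSq 𝒯 S T (u k) := by
  rw [etaSeminormSq, Gh_eq (h.eigen k hk).memS (h.eigen k hk).eq1, etaSq]

end Eigensystem

/-! ### Local comparison of the two estimators -/

theorem lemmal {d : ℕ} (hd : d = 2 ∨ d = 3) {Ω : Set (Euc d)} (𝒯 : Triangulation Ω)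
    (S : Submodule ℝ (L2Vec Ω)) (M : Submodule ℝ (L2Fun Ω)) (hSM : IsMixedFE 𝒯 S M)
    (lam : ℕ → ℝ) (σ : ℕ → L2Vec Ω) (u : ℕ → L2Fun Ω)
    (hsys : IsEigensystem (Hdiv Ω) ⊤ {i | 1 ≤ i} lam σ u)
    (lamh : ℕ → ℝ) (σh : ℕ → L2Vec Ω) (uh : ℕ → L2Fun Ω)
    (hsysh : IsEigensystem S M {i | 1 ≤ i ∧ i ≤ Module.finrank ℝ M} lamh σh uh)
    (n N : ℕ) (hN : 0 < N) (hnN : n + N ≤ Module.finrank ℝ M)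
    (J : Finset ℕ) (hJ : J = Finset.Icc (n + 1) (n + N))
    (A B : ℝ) (hA : 0 < A)
    (hAB : ∀ j ∈ J, lam j ∈ Set.Icc A B ∧ lamh j ∈ Set.Icc A B)
    (heps : ∀ j ∈ J,
      ‖u j - Lambdah S M uh J (lam j) (u j)‖ ≤ Real.sqrt (1 + 1 / (2 * (N : ℝ))) - 1)
    (T : Finset (Euc d)) (hT : T ∈ 𝒯.cells) :
    (N : ℝ)⁻¹ * ∑ j ∈ J, muSq 𝒯 S M uh J T (lam j) (u j)
        ≤ (B / A) ^ 2 * ∑ j ∈ J, etaSq 𝒯 T (σh j) (uh j) ∧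
      (B / A) ^ 2 * ∑ j ∈ J, etaSq 𝒯 T (σh j) (uh j)
        ≤ (B / A) ^ 2 * (2 * (N : ℝ) + 4 * (N : ℝ) ^ 2)
            * ∑ j ∈ J, muSq 𝒯 S M uh J T (lam j) (u j) := by
  have hd0 : d ≠ 0 := by omega
  have hNR : (0 : ℝ) < N := by exact_mod_cast hN
  have hcard : J.card = N := by simp [hJ]
  have hJ1 : (J : Set ℕ) ⊆ {i | 1 ≤ i} := by
    intro j hj
    simp only [hJ, Finset.coe_Icc, Set.mem_Icc] at hj
    exact (by omega : 1 ≤ j)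
  have hJh : (J : Set ℕ) ⊆ {i | 1 ≤ i ∧ i ≤ Module.finrank ℝ M} := by
    intro j hj
    simp only [hJ, Finset.coe_Icc, Set.mem_Icc] at hj
    exact (by omega : 1 ≤ j ∧ j ≤ Module.finrank ℝ M)
  have hu := hsys.orthonormal hJ1
  have hΛW : ∀ j, Lambdah S M uh J (lam j) (u j) ∈ Wh uh J := fun j =>
    Submodule.starProjection_apply_mem _ _
  have hgraph : ∀ w ∈ Wh uh J, ∃ v ∈ ghGraph S M, (v.2 : L2Fun Ω) = w := fun w hw =>
    hsysh.mem_ghGraph_of_mem_Wh hJh hw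
  have huhW : ∀ k ∈ J, uh k ∈ Wh uh J := fun k hk => Submodule.subset_span ⟨k, hk, rfl⟩
  have hsqrt : Real.sqrt (1 + 1 / (2 * (N : ℝ))) < 2 := by
    rw [Real.sqrt_lt' (by norm_num)]
    have h1 : (1 : ℝ) ≤ N := by exact_mod_cast hN
    have h2 : 1 / (2 * (N : ℝ)) ≤ 1 := (div_le_one (by positivity)).2 (by linarith)
    linarith
  -- If `T_h` vanished, as its default value does, the distance in `heps` would be `‖u j‖ = 1`, but
  -- the permitted bound is below `1`. Hence the discrete source problem is solvable.
  have hTh : ∀ j ∈ J, Th S M (lam j) (u j) ≠ 0 := by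
    intro j hj h0
    have h1 := heps j hj
    rw [Lambdah, h0, map_zero, sub_zero, hsys.norm_one j (hJ1 hj)] at h1
    linarith
  rw [Finset.sum_congr rfl fun k hk => hsysh.etaSq_eq 𝒯 T (hJh hk)]
  set Q := etaSeminormSq 𝒯 S T with hQ
  change (N : ℝ)⁻¹ * ∑ j ∈ J, Q (Lambdah S M uh J (lam j) (u j)) ≤ (B / A) ^ 2 * ∑ j ∈ J, Q (uh j) ∧
    (B / A) ^ 2 * ∑ j ∈ J, Q (uh j)
      ≤ (B / A) ^ 2 * (2 * (N : ℝ) + 4 * (N : ℝ) ^ 2)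
        * ∑ j ∈ J, Q (Lambdah S M uh J (lam j) (u j))
  have hQuh : 0 ≤ ∑ j ∈ J, Q (uh j) := Finset.sum_nonneg fun j hj =>
    etaSeminormSq_nonneg hSM hd0 hT (hgraph _ (huhW j hj))
  have hQΛ : 0 ≤ ∑ j ∈ J, Q (Lambdah S M uh J (lam j) (u j)) := Finset.sum_nonneg fun j _ =>
    etaSeminormSq_nonneg hSM hd0 hT (hgraph _ (hΛW j))
  constructor
  · rw [inv_mul_le_iff₀ hNR]
    have hle : ∀ j ∈ J, Q (Lambdah S M uh J (lam j) (u j))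
        ≤ (B / A) ^ 2 * ∑ k ∈ J, Q (uh k) := by
      intro j hj
      rw [hsysh.Lambdah_eq hJh (hTh j hj)]
      refine (etaSeminormSq_sum_le hSM hd0 hT J _ uh fun k hk => hgraph _ (huhW k hk)).trans
        (mul_le_mul_of_nonneg_right ?_ hQuh)
      calc ∑ k ∈ J, (lam j / lamh k * inner ℝ (uh k) (u j)) ^ 2
          ≤ ∑ k ∈ J, (B / A) ^ 2 * inner ℝ (uh k) (u j) ^ 2 := by
            refine Finset.sum_le_sum fun k hk => ?_
            obtain ⟨⟨h1, h2⟩, -⟩ := hAB j hj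
            obtain ⟨-, h3, h4⟩ := hAB k hk
            rw [mul_pow]
            have h5 : 0 ≤ lam j / lamh k := div_nonneg (by linarith) (by linarith)
            have h6 : lam j / lamh k ≤ B / A := div_le_div₀ (by linarith) h2 hA h3
            gcongr
        _ = (B / A) ^ 2 * ∑ k ∈ J, inner ℝ (uh k) (u j) ^ 2 := by rw [Finset.mul_sum]
        _ ≤ (B / A) ^ 2 * 1 := by
            refine mul_le_mul_of_nonneg_left ?_ (sq_nonneg _)
            have h1 := (hsysh.orthonormal hJh).sum_inner_sq_le (u j)
            rwa [hsys.norm_one j (hJ1 hj), one_pow] at h1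
        _ = (B / A) ^ 2 := mul_one _
    have h1 := Finset.sum_le_card_nsmul J _ _ hle
    rwa [hcard, nsmul_eq_mul] at h1
  · have hγ := hu.sum_sq_le_of_norm_sub_le (by omega)
      (w := fun j => Lambdah S M uh J (lam j) (u j)) (by rwa [hcard])
    have hspan := span_image_eq_of_sum_sq_le (u := uh) (fun j _ => hΛW j) hγ
    have hle : ∀ k ∈ J, Q (uh k) ≤ 2 * ∑ j ∈ J, Q (Lambdah S M uh J (lam j) (u j)) := by
      intro k hk
      have hmem : uh k ∈ Submodule.span ℝ
          ((fun j => Lambdah S M uh J (lam j) (u j)) '' (J : Set ℕ)) := hspan ▸ huhW k hk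
      obtain ⟨γ, hγk⟩ : ∃ γ : ℕ → ℝ,
          ∑ j ∈ J, γ j • Lambdah S M uh J (lam j) (u j) = uh k :=
        Submodule.mem_span_image_finset_iff_exists_fun' ℝ |>.1 hmem
      have h1 := hγ γ
      have h2 := etaSeminormSq_sum_le hSM hd0 hT J γ _ fun j _ => hgraph _ (hΛW j)
      simp only [hγk] at h1 h2
      -- As `‖u_{h,k}‖ = 1`, the coefficients satisfy `∑ γ_j² ≤ 2`.
      rw [hsysh.norm_one k (hJh hk), one_pow, mul_one] at h1
      exact h2.trans (mul_le_mul_of_nonneg_right h1 hQΛ)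
    have h1 := Finset.sum_le_card_nsmul J _ _ hle
    rw [hcard, nsmul_eq_mul] at h1
    rw [mul_assoc]
    -- The bound `2 N` is already proved; the term `4 N²` is slack, discarded by nonnegativity.
    refine mul_le_mul_of_nonneg_left (h1.trans ?_) (sq_nonneg _)
    nlinarith [mul_nonneg (sq_nonneg (N : ℝ)) hQΛ]
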